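/- Theorem 1. Let $J\in\mathbb R^{N\times p}$ be a matrix of rank $r$ with compact singular value decomposition $J=U\Sigma V^\top$ ($U\in\mathbb R^{N\times r}$, $V\in\mathbb R^{p\times r}$ with orthonormal columns, $\Sigma$ diagonal with positive entries), and assume that $J$ is $\mu$-incoherent, i.e. its coherence $\frac Nr\max_{1\le i\le N}\|U^\top e_i\|_2^2$ is at most $\mu$ (for $r=0$ the coherence is read as $0$). Let $s_\star\in\mathbb R^N$ be $k$-sparse (at most $k$ nonzero entries), let $\theta_\star\in\mathbb R^p$ and $y=J\theta_\star+s_\star$, where $\theta_\star$ has minimal $\ell_2$-norm among all $\theta$ with $y=J\theta+s_\star$. Assume $k^2r<\frac{N}{4\mu}$. For $\alpha>0$, $\gamma\in(0,1)$ and $\tau>0$ consider gradient descent on $\frac12\|J\theta+u\odot u-v\odot v-y\|_2^2$ with learning rate $\tau$ for $\theta$ and $\alpha\tau$ for $u$ and $v$, $$\theta_{j+1}=\theta_j-\tau J^\top r_j,\quad u_{j+1}=u_j-2\alpha\tau\,u_j\odot r_j,\quad v_{j+1}=v_j+2\alpha\tau\,v_j\odot r_j,\qquad r_j=J\theta_j+u_j\odot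 u_j-v_j\odot v_j-y,$$ started at $\theta_0=0$, $u_0=v_0=\gamma\mathbf 1$. Then there is $\lambda_0>0$, depending only on $(J,\theta_\star,k)$, such that for every $\lambda>\lambda_0$ and with the choice $\alpha=\alpha(\gamma)=-\frac{\log\gamma}{2\lambda}$ the following holds. (a) For every $\gamma\in(0,1)$ the gradient flow $$\dot\theta_t=-J^\top r_t,\quad \dot u_t=-2\alpha\,u_t\odot r_t,\quad \dot v_t=2\alpha\,v_t\odot r_t,\qquad r_t=J\theta_t+u_t\odot u_t-v_t\odot v_t-y,$$ with the same initial values has exactly one solution on $[0,\infty)$, and it is the limit $\tau\to0$ of gradient descent: for every $t\ge0$ the iterate with index $\lfloor t/\tau\rfloor$ converges to $(\theta_t,u_t,v_t)$ as $\tau\to0^+$. (b) For every $\gamma\in(0,1)$ this flow converges, as $t\to\infty$, to a limit $(\theta_\infty(\gamma),u_\infty(\gamma),v_\infty(\gamma))$. (c) As $\gamma\to0^+$, these limits converge to the ground truth: $\theta_\infty(\gamma)\to\theta_\star$, $u_\infty(\gamma)\to\hat u$ and $v_\infty(\gamma)\to\hat v$ for some $\hat u,\hat v\in\mathbb R^N$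 with $\hat u\odot\hat u-\hat v\odot\hat v=s_\star$. -/

import Mathlib

open Filter Topology Matrix

namespace SparseOverparam

noncomputable section

/-- The squared Euclidean norm of a real vector. -/
def sqNorm {n : ℕ} (x : Fin n → ℝ) : ℝ := ∑ i, x i ^ 2

/-- The vector `s` has at most `k` nonzero entries. -/
def IsSparse {n : ℕ} (k : ℕ) (s : Fin n → ℝ) : Prop :=
  (Finset.univ.filter fun i => s i ≠ 0).card ≤ k

/-- `J = U Σ Vᵀ` is a compact singular value decomposition: `U` and `V` have orthonormal columns
and `Σ` is a diagonal matrix with (strictly) positive diagonal entries. -/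
structure IsCompactSVD {N p r : ℕ} (J : Matrix (Fin N) (Fin p) ℝ)
    (U : Matrix (Fin N) (Fin r) ℝ) (σ : Fin r → ℝ) (V : Matrix (Fin p) (Fin r) ℝ) : Prop where
  orth_left : Uᵀ * U = 1
  orth_right : Vᵀ * V = 1
  pos : ∀ j, 0 < σ j
  eq : J = U * Matrix.diagonal σ * Vᵀ

/-- The coherence `(N / r) * max_i ‖Uᵀ e_i‖²` read off from the left singular vectors. -/
def coherence {N r : ℕ} (U : Matrix (Fin N) (Fin r) ℝ) : ℝ :=
  (N : ℝ) / (r : ℝ) * ⨆ i : Fin N, sqNorm (Uᵀ *ᵥ (Pi.single i (1 : ℝ)))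

/-- The rank-`r` matrix `J` is `μ`-incoherent: its coherence is at most `μ`. The number
`‖Uᵀ e_i‖` is the length of the projection of `e_i` to the column space of `J`, so that the
coherence does not depend on the choice of the compact singular value decomposition. -/
def IsIncoherent {N p : ℕ} (J : Matrix (Fin N) (Fin p) ℝ) (r : ℕ) (μ : ℝ) : Prop :=
  ∃ (U : Matrix (Fin N) (Fin r) ℝ) (σ : Fin r → ℝ) (V : Matrix (Fin p) (Fin r) ℝ),
    IsCompactSVD J U σ V ∧ coherence U ≤ μ

/-- `θ` has minimal Euclidean norm among the solutions of `y = J θ + s`. -/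
def IsMinNormSolution {N p : ℕ} (J : Matrix (Fin N) (Fin p) ℝ) (s y : Fin N → ℝ)
    (θ : Fin p → ℝ) : Prop :=
  y = J *ᵥ θ + s ∧ ∀ θ' : Fin p → ℝ, y = J *ᵥ θ' + s → sqNorm θ ≤ sqNorm θ'

/-- The triples `(θ, u, v)`. -/
abbrev Params (N p : ℕ) : Type := (Fin p → ℝ) × (Fin N → ℝ) × (Fin N → ℝ)

/-- The residual `J θ + u ⊙ u - v ⊙ v - y`. -/
def residual {N p : ℕ} (J : Matrix (Fin N) (Fin p) ℝ) (y : Fin N → ℝ) (z : Params N p) :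
    Fin N → ℝ :=
  J *ᵥ z.1 + z.2.1 * z.2.1 - z.2.2 * z.2.2 - y

/-- The objective `½ ‖J θ + u ⊙ u - v ⊙ v - y‖²`. -/
def loss {N p : ℕ} (J : Matrix (Fin N) (Fin p) ℝ) (y : Fin N → ℝ) (z : Params N p) : ℝ :=
  1 / 2 * sqNorm (residual J y z)

/-- The negative gradient of the objective, as `(θ, u, v)` components. -/
def negGrad {N p : ℕ} (J : Matrix (Fin N) (Fin p) ℝ) (y : Fin N → ℝ) (z : Params N p) :
    Params N p :=
  (-(Jᵀ *ᵥ residual J y z),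
    (-2 : ℝ) • (z.2.1 * residual J y z),
    (2 : ℝ) • (z.2.2 * residual J y z))

/-- The directional derivatives of `loss` are the inner products with `-negGrad`. -/
theorem loss_hasDerivAt {N p : ℕ} (J : Matrix (Fin N) (Fin p) ℝ) (y : Fin N → ℝ)
    (z d : Params N p) :
    HasDerivAt (fun t : ℝ => loss J y (z + t • d))
      (-((negGrad J y z).1 ⬝ᵥ d.1 + (negGrad J y z).2.1 ⬝ᵥ d.2.1
        + (negGrad J y z).2.2 ⬝ᵥ d.2.2)) 0 := by
  have hr : ∀ i, HasDerivAt (fun t : ℝ => residual J y (z + t • d) i)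
      ((J *ᵥ d.1) i + 2 * z.2.1 i * d.2.1 i - 2 * z.2.2 i * d.2.2 i) 0 := by
    intro i
    have hu : HasDerivAt (fun t : ℝ => z.2.1 i + t * d.2.1 i) (d.2.1 i) 0 := by
      simpa using ((hasDerivAt_id (0 : ℝ)).mul_const (d.2.1 i)).const_add (z.2.1 i)
    have hv : HasDerivAt (fun t : ℝ => z.2.2 i + t * d.2.2 i) (d.2.2 i) 0 := by
      simpa using ((hasDerivAt_id (0 : ℝ)).mul_const (d.2.2 i)).const_add (z.2.2 i)
    have hJ : HasDerivAt (fun t : ℝ => (J *ᵥ z.1) i + t * (J *ᵥ d.1) i) ((J *ᵥ d.1) i) 0 := by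
      simpa using ((hasDerivAt_id (0 : ℝ)).mul_const ((J *ᵥ d.1) i)).const_add ((J *ᵥ z.1) i)
    have h := ((hJ.add (hu.mul hu)).sub (hv.mul hv)).sub_const (y i)
    have hf : (fun t : ℝ => residual J y (z + t • d) i) = fun t : ℝ =>
        (J *ᵥ z.1) i + t * (J *ᵥ d.1) i + (z.2.1 i + t * d.2.1 i) * (z.2.1 i + t * d.2.1 i)
          - (z.2.2 i + t * d.2.2 i) * (z.2.2 i + t * d.2.2 i) - y i := by
      funext t
      simp [residual, Matrix.mulVec_add, Matrix.mulVec_smul]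
    rw [hf]
    exact h.congr_deriv (by ring)
  have h := (HasDerivAt.fun_sum (u := Finset.univ) fun i _ => (hr i).pow 2).const_mul (1 / 2 : ℝ)
  refine HasDerivAt.congr_deriv (f := fun t : ℝ => loss J y (z + t • d)) h ?_
  have e : (Jᵀ *ᵥ residual J y z) ⬝ᵥ d.1 = residual J y z ⬝ᵥ (J *ᵥ d.1) := by
    rw [Matrix.mulVec_transpose, Matrix.dotProduct_mulVec]
  simp only [negGrad, neg_dotProduct, e]
  simp only [dotProduct, ← Finset.sum_neg_distrib, ← Finset.sum_add_distrib, Finset.mul_sum]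
  refine Finset.sum_congr rfl fun i _ => ?_
  simp
  ring

/-- The direction of motion: the negative gradient, with relative learning rate `1` for `θ`
and `α` for `u` and `v`. -/
def direction {N p : ℕ} (J : Matrix (Fin N) (Fin p) ℝ) (y : Fin N → ℝ) (α : ℝ)
    (z : Params N p) : Params N p :=
  ((negGrad J y z).1, α • (negGrad J y z).2.1, α • (negGrad J y z).2.2)

/-- The initialization `θ = 0`, `u = v = γ 1`. -/
def initial (N p : ℕ) (γ : ℝ) : Params N p := (0, fun _ => γ, fun _ => γ)

/-- The gradient descent iterates, with learning rate `τ` for `θ` and `α τ` for `u` and `v`,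
started at the initialization of scale `γ`. -/
def gradDescent {N p : ℕ} (J : Matrix (Fin N) (Fin p) ℝ) (y : Fin N → ℝ) (α γ τ : ℝ) :
    ℕ → Params N p
  | 0 => initial N p γ
  | j + 1 => gradDescent J y α γ τ j + τ • direction J y α (gradDescent J y α γ τ j)

/-- `z` solves the gradient flow equations on `[0, ∞)`, with the initialization of
scale `γ`. -/
def IsGradientFlow {N p : ℕ} (J : Matrix (Fin N) (Fin p) ℝ) (y : Fin N → ℝ) (α γ : ℝ)
    (z : ℝ → Params N p) : Prop :=
  z 0 = initial N p γ ∧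
    ∀ t : ℝ, 0 ≤ t → HasDerivWithinAt z (direction J y α (z t)) (Set.Ici 0) t

/-- `z` is the trajectory of gradient descent in the limit of vanishing learning rate `τ`:
it is the one and only solution of the gradient flow on `[0, ∞)`, and at each time `t` it is
the limit of the gradient descent iterates after `⌊t / τ⌋` steps as `τ → 0`. -/
def IsLimitDynamics {N p : ℕ} (J : Matrix (Fin N) (Fin p) ℝ) (y : Fin N → ℝ) (α γ : ℝ)
    (z : ℝ → Params N p) : Prop :=
  IsGradientFlow J y α γ z ∧
  (∀ z' : ℝ → Params N p, IsGradientFlow J y α γ z' → ∀ t : ℝ, 0 ≤ t → z' t = z t) ∧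
  ∀ t : ℝ, 0 ≤ t →
    Tendsto (fun τ : ℝ => gradDescent J y α γ τ ⌊t / τ⌋₊) (𝓝[>] 0) (𝓝 (z t))

end

end SparseOverparam

/-! Let `ν` be minus the time integral of the residual. The flow integrates in closed form: `θ = Jᵀ
ν`, `u = γ exp(2αν)`, `v = γ exp(-2αν)`. Hence `u² - v² = 2γ² sinh(4αν)`, and `ν` runs down a
strongly convex potential (`residual_paramsOfDual`, `exists_dual_flow`). This gives convergence for
fixed `γ`, with limit read off from the zero of `dualGrad`. Uniqueness and the Euler limit need only
that the field is Lipschitz on balls.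

As `γ → 0` with `4α = -2 log γ / λ`, the map `ν ↦ 2γ² sinh(4αν)` degenerates to the monotone graph
that is `0` for `|ν| < λ` and vertical at `±λ`. The zero equation thus formally becomes the
optimality system of minimizing `½‖θ‖² + λ‖s‖₁` subject to `Jθ + s = y`. The ground truth solves it
if some `νc` has `Jᵀ νc = θ⋆`, equals `λ sign s⋆` on the support and is below `λ` in modulus
elsewhere. By incoherence the entries of the projection `U Uᵀ` are at most `μr/N`, so a preimage
`ν₀` of `θ⋆` can be corrected within the kernel of `Jᵀ` to such a certificate as soon as `λ > 2‖ν₀‖`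
(`exists_dual_certificate`).

Testing the zero equation with `ν - νc` gives `‖Jᵀ(ν - νc)‖² + ∑ (ν - νc)(2γ² sinh(4αν) - s⋆) = 0`.
By monotonicity the sum is nonnegative up to vanishing errors (`exists_error_bounds`). So `Jᵀ ν →
θ⋆`, hence `u² - v² → s⋆`, and `u v = γ²` yields the limits of `u` and `v`. -/

namespace SparseOverparam

/-! ### Autonomous ODEs: uniqueness, global existence, Euler's method -/

section ODE

open Metric Set

variable {E : Type*} [NormedAddCommGroup E] [NormedSpace ℝ E]

/-- Solutions of an autonomous ODE on `[0, T]` are unique if the field is Lipschitz on balls. -/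
theorem eqOn_of_hasDerivWithinAt_of_lipschitzOn_balls {F : E → E}
    (hF : ∀ R : ℝ, ∃ K, LipschitzOnWith K F (closedBall 0 R)) {T : ℝ} {x x' : ℝ → E}
    (hx : ∀ t ∈ Icc 0 T, HasDerivWithinAt x (F (x t)) (Icc 0 T) t)
    (hx' : ∀ t ∈ Icc 0 T, HasDerivWithinAt x' (F (x' t)) (Icc 0 T) t) (h0 : x 0 = x' 0) :
    EqOn x x' (Icc 0 T) := by
  have hc : ContinuousOn x (Icc 0 T) := fun t ht => (hx t ht).continuousWithinAt
  have hc' : ContinuousOn x' (Icc 0 T) := fun t ht => (hx' t ht).continuousWithinAt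
  obtain ⟨R, hR⟩ := isCompact_Icc.exists_bound_of_continuousOn hc
  obtain ⟨R', hR'⟩ := isCompact_Icc.exists_bound_of_continuousOn hc'
  obtain ⟨K, hK⟩ := hF (max R R')
  have key : ∀ t ∈ Ico 0 T, Icc 0 T ∈ 𝓝[Ici t] t := fun t ht =>
    mem_of_superset (Icc_mem_nhdsGE ht.2) (Icc_subset_Icc_left ht.1)
  refine ODE_solution_unique_of_mem_Icc_right (v := fun _ => F)
    (s := fun _ => closedBall 0 (max R R'))
    (fun _ _ => hK) hc (fun t ht => ?_) (fun t ht => ?_) hc' (fun t ht => ?_) (fun t ht => ?_) h0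
  · exact (hx t (Ico_subset_Icc_self ht)).mono_of_mem_nhdsWithin (key t ht)
  · simpa using Or.inl (hR t (Ico_subset_Icc_self ht))
  · exact (hx' t (Ico_subset_Icc_self ht)).mono_of_mem_nhdsWithin (key t ht)
  · simpa using Or.inr (hR' t (Ico_subset_Icc_self ht))

/-- Global existence for a bounded Lipschitz field. -/
theorem exists_hasDerivWithinAt_Ici_of_bounded_lipschitz [CompleteSpace E] {F : E → E}
    {K L : NNReal} (hK : LipschitzWith K F) (hL : ∀ x, ‖F x‖ ≤ L) (x₀ : E) :
    ∃ x : ℝ → E, x 0 = x₀ ∧ ∀ t, 0 ≤ t → HasDerivWithinAt x (F (x t)) (Ici 0) t := by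
  have hex : ∀ n : ℕ, ∃ x : ℝ → E, x 0 = x₀ ∧
      ∀ t ∈ Icc (0 : ℝ) n, HasDerivWithinAt x (F (x t)) (Icc 0 (n : ℝ)) t := by
    intro n
    have h0 : (0 : ℝ) ∈ Icc (0 : ℝ) n := ⟨le_rfl, n.cast_nonneg⟩
    -- The speed is at most `L` everywhere, so radius `L * n` suffices up to time `n`.
    have hp : IsPicardLindelof (fun _ => F) (⟨0, h0⟩ : Icc (0 : ℝ) n) x₀ (L * n) 0 L K := by
      refine IsPicardLindelof.of_time_independent (fun x _ => hL x) hK.lipschitzOnWith ?_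
      simp
    exact hp.exists_eq_forall_mem_Icc_hasDerivWithinAt₀
  choose x hx0 hx using hex
  have hmono : ∀ m n : ℕ, m ≤ n → EqOn (x m) (x n) (Icc 0 (m : ℝ)) := by
    intro m n hmn
    have hs : Icc (0 : ℝ) m ⊆ Icc (0 : ℝ) n := Icc_subset_Icc_right (by exact_mod_cast hmn)
    exact eqOn_of_hasDerivWithinAt_of_lipschitzOn_balls (fun R => ⟨K, hK.lipschitzOnWith⟩) (hx m)
      (fun t ht => (hx n t (hs ht)).mono hs) ((hx0 m).trans (hx0 n).symm)
  have heq : ∀ (n : ℕ) (t : ℝ), 0 ≤ t → t ≤ n → x ⌈t⌉₊ t = x n t := fun n t h0 hn =>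
    hmono _ _ (Nat.ceil_le.2 hn) ⟨h0, Nat.le_ceil t⟩
  refine ⟨fun t => x ⌈t⌉₊ t, by simp [hx0], fun t ht => ?_⟩
  set n := ⌈t⌉₊ + 1 with hn
  have htn : t < n := by
    rw [hn]; push_cast; linarith [Nat.le_ceil t]
  have h1 : HasDerivWithinAt (x n) (F (x n t)) (Ici 0) t := by
    refine (hx n t ⟨ht, htn.le⟩).mono_of_mem_nhdsWithin ?_
    rw [← Ici_inter_Iic]
    exact inter_mem self_mem_nhdsWithin (mem_nhdsWithin_of_mem_nhds (Iic_mem_nhds htn))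
  have h2 : (fun t => x ⌈t⌉₊ t) =ᶠ[𝓝[Ici 0] t] x n := by
    filter_upwards [self_mem_nhdsWithin, mem_nhdsWithin_of_mem_nhds (Iic_mem_nhds htn)]
      with s hs hs' using heq n s hs hs'
  have h3 := heq n t ht htn.le
  simp only [h3]
  exact h1.congr_of_eventuallyEq h2 h3

/-- Convergence of the explicit Euler method. -/
theorem tendsto_euler {F : E → E}
    (hF : ∀ R : ℝ, ∃ K, LipschitzOnWith K F (closedBall 0 R)) {z : ℝ → E}
    (hz : ∀ t, 0 ≤ t → HasDerivWithinAt z (F (z t)) (Ici 0) t) {x : ℝ → ℕ → E}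
    (h0 : ∀ τ, x τ 0 = z 0) (hx : ∀ τ n, x τ (n + 1) = x τ n + τ • F (x τ n)) {t : ℝ}
    (ht : 0 ≤ t) : Tendsto (fun τ : ℝ => x τ ⌊t / τ⌋₊) (𝓝[>] 0) (𝓝 (z t)) := by
  have hzI : ∀ s ∈ Icc 0 t, HasDerivWithinAt z (F (z s)) (Icc 0 t) s := fun s hs =>
    (hz s hs.1).mono Icc_subset_Ici_self
  have hc : ContinuousOn z (Icc 0 t) := fun s hs => (hzI s hs).continuousWithinAt
  obtain ⟨R, hR⟩ := isCompact_Icc.exists_bound_of_continuousOn hc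
  -- The margin `1` leaves room for the Euler iterates, which only stay near the trajectory.
  obtain ⟨K, hK⟩ := hF (R + 1)
  have hmem : ∀ s ∈ Icc 0 t, z s ∈ closedBall (0 : E) (R + 1) := fun s hs => by
    rw [mem_closedBall_zero_iff]; linarith [hR s hs]
  have hFz : ContinuousOn (fun s => F (z s)) (Icc 0 t) := hK.continuousOn.comp hc hmem
  obtain ⟨M, hM⟩ := isCompact_Icc.exists_bound_of_continuousOn hFz
  have hM0 : 0 ≤ M := (norm_nonneg _).trans (hM 0 ⟨le_rfl, ht⟩)
  have hlip : ∀ a ∈ Icc 0 t, ∀ b ∈ Icc 0 t, ‖z b - z a‖ ≤ M * ‖b - a‖ := fun a ha b hb =>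
    (convex_Icc 0 t).norm_image_sub_le_of_norm_hasDerivWithin_le hzI hM ha hb
  -- Local truncation error, from the mean value inequality for `s ↦ z s - s • F (z a)`.
  have hloc : ∀ a ∈ Icc 0 t, ∀ b ∈ Icc 0 t, a ≤ b →
      ‖z b - z a - (b - a) • F (z a)‖ ≤ K * M * (b - a) * (b - a) := by
    intro a ha b hb hab
    have hs : Icc a b ⊆ Icc 0 t := Icc_subset_Icc ha.1 hb.2
    have hd : ∀ s ∈ Icc a b, HasDerivWithinAt (fun s => z s - s • F (z a))
        (F (z s) - F (z a)) (Icc a b) s := fun s hs' => by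
      simpa using ((hzI s (hs hs')).mono hs).fun_sub
        ((hasDerivWithinAt_id s (Icc a b)).smul_const (F (z a)))
    have hbd : ∀ s ∈ Icc a b, ‖F (z s) - F (z a)‖ ≤ K * M * (b - a) := fun s hs' => by
      have h1 := hK.norm_sub_le (hmem s (hs hs')) (hmem a ha)
      have h2 := hlip a ha s (hs hs')
      rw [Real.norm_eq_abs, abs_of_nonneg (by linarith [hs'.1])] at h2
      have h3 : M * (s - a) ≤ M * (b - a) := by gcongr; exact hs'.2
      calc _ ≤ (K : ℝ) * ‖z s - z a‖ := h1
        _ ≤ K * (M * (b - a)) := by gcongr; linarith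
        _ = _ := by ring
    have := (convex_Icc a b).norm_image_sub_le_of_norm_hasDerivWithin_le hd hbd
      (left_mem_Icc.2 hab) (right_mem_Icc.2 hab)
    rw [Real.norm_eq_abs, abs_of_nonneg (by linarith : 0 ≤ b - a)] at this
    convert this using 2
    rw [sub_smul]; abel
  set C := M * Real.exp (K * t) with hC
  have hC0 : 0 ≤ C := by positivity
  have hpow : ∀ τ : ℝ, 0 < τ → ∀ n : ℕ, n * τ ≤ t →
      τ * M * ((1 + K * τ) ^ n - 1) ≤ τ * C := by
    intro τ hτ n hn
    have h1 : (1 + K * τ) ^ n ≤ Real.exp (K * t) :=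
      calc (1 + K * τ) ^ n ≤ (Real.exp (K * τ)) ^ n := by
            gcongr; linarith [Real.add_one_le_exp (K * τ)]
        _ = Real.exp (K * (n * τ)) := by rw [← Real.exp_nat_mul]; congr 1; ring
        _ ≤ _ := by gcongr
    rw [hC, ← mul_assoc]
    gcongr
    linarith
  -- Discrete Grönwall for `e (n+1) ≤ (1 + Kτ) e n + KMτ²`; `τ * C ≤ 1` keeps the iterates in the
  -- ball where `K` is valid.
  have hbound : ∀ τ : ℝ, 0 < τ → τ * C ≤ 1 → ∀ n : ℕ, n * τ ≤ t →
      ‖x τ n - z (n * τ)‖ ≤ τ * M * ((1 + K * τ) ^ n - 1) := by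
    intro τ hτ hτC n
    induction n with
    | zero => intro _; simp [h0]
    | succ n ih =>
      intro hn
      push_cast at hn ⊢
      have hn' : n * τ ≤ t := by linarith
      have hI : (n * τ : ℝ) ∈ Icc 0 t := ⟨by positivity, hn'⟩
      have hI' : ((n + 1) * τ : ℝ) ∈ Icc 0 t := ⟨by positivity, hn⟩
      have ih := ih hn'
      have hxb : x τ n ∈ closedBall (0 : E) (R + 1) := by
        rw [mem_closedBall_zero_iff]
        have h1 := hR _ hI
        have h2 := norm_le_insert' (x τ n) (z (n * τ))
        linarith [hpow τ hτ n hn']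
      have h1 := hK.norm_sub_le hxb (hmem _ hI)
      have h2 := hloc _ hI _ hI' (by linarith)
      rw [show ((n + 1) * τ - n * τ : ℝ) = τ by ring] at h2
      have h3 : x τ (n + 1) - z ((n + 1) * τ) = (x τ n - z (n * τ)) +
          τ • (F (x τ n) - F (z (n * τ))) - (z ((n + 1) * τ) - z (n * τ) - τ • F (z (n * τ))) := by
        rw [hx, smul_sub]; abel
      rw [h3]
      calc _ ≤ ‖x τ n - z (n * τ)‖ + τ * (K * ‖x τ n - z (n * τ)‖) + K * M * τ * τ := by
            refine (norm_sub_le _ _).trans (add_le_add ((norm_add_le _ _).trans ?_) h2)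
            rw [norm_smul, Real.norm_of_nonneg hτ.le]
            gcongr
        _ = (1 + K * τ) * ‖x τ n - z (n * τ)‖ + K * M * τ * τ := by ring
        _ ≤ (1 + K * τ) * (τ * M * ((1 + K * τ) ^ n - 1)) + K * M * τ * τ := by gcongr
        _ = _ := by ring
  have hfinal : ∀ᶠ τ : ℝ in 𝓝[>] 0, ‖x τ ⌊t / τ⌋₊ - z t‖ ≤ τ * (C + M) := by
    have h1 : ∀ᶠ τ : ℝ in 𝓝[>] 0, τ * C < 1 := by
      refine mem_nhdsWithin_of_mem_nhds ?_
      exact (continuous_id.mul continuous_const).continuousAt.eventually_lt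
        continuousAt_const (by simp)
    filter_upwards [self_mem_nhdsWithin, h1] with τ (hτ : 0 < τ) hτC
    set n := ⌊t / τ⌋₊ with hn
    have hnt : n * τ ≤ t := by
      rw [← le_div_iff₀ hτ]; exact Nat.floor_le (by positivity)
    have hnt' : t ≤ n * τ + τ := by
      have := (Nat.lt_floor_add_one (t / τ)).le
      rw [div_le_iff₀ hτ] at this
      linarith
    have hI : (n * τ : ℝ) ∈ Icc 0 t := ⟨by positivity, hnt⟩
    have h2 := hbound τ hτ hτC.le n hnt
    have h3 := hlip t ⟨ht, le_rfl⟩ _ hI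
    have h4 : ‖n * τ - t‖ ≤ τ := by rw [Real.norm_eq_abs, abs_le]; constructor <;> linarith
    have h5 := hpow τ hτ n hnt
    calc ‖x τ n - z t‖ = ‖(x τ n - z (n * τ)) + (z (n * τ) - z t)‖ := by congr 1; abel
      _ ≤ ‖x τ n - z (n * τ)‖ + ‖z (n * τ) - z t‖ := norm_add_le _ _
      _ ≤ τ * C + M * τ := by gcongr <;> [linarith; exact h3.trans (by gcongr)]
      _ = _ := by ring
  rw [tendsto_iff_norm_sub_tendsto_zero]
  refine squeeze_zero' (Eventually.of_forall fun _ => norm_nonneg _) hfinal ?_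
  have : Tendsto (fun τ : ℝ => τ * (C + M)) (𝓝 0) (𝓝 (0 * (C + M))) :=
    tendsto_id.mul_const _
  rw [zero_mul] at this
  exact this.mono_left nhdsWithin_le_nhds

/-- A `C¹` field on a finite-dimensional space is Lipschitz on balls. -/
theorem lipschitzOn_balls_of_contDiff [FiniteDimensional ℝ E] {F : E → E} (hF : ContDiff ℝ 1 F)
    (R : ℝ) : ∃ K, LipschitzOnWith K F (closedBall 0 R) := by
  have : ProperSpace E := FiniteDimensional.proper ℝ E
  exact hF.contDiffOn.exists_lipschitzOnWith one_ne_zero (convex_closedBall 0 R)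
    (isCompact_closedBall 0 R)

end ODE

/-! ### The dual variable and its strongly monotone flow -/

section DualFlow

open Metric Set

variable {N p : ℕ} (J : Matrix (Fin N) (Fin p) ℝ) (y : Fin N → ℝ) (α γ : ℝ)

/-- The parameters reached by the flow when the time integral of the residual is `-ν`. -/
noncomputable def paramsOfDual (ν : Fin N → ℝ) : Params N p :=
  (Jᵀ *ᵥ ν, fun i => γ * Real.exp (2 * α * ν i), fun i => γ * Real.exp (-(2 * α * ν i)))

/-- The residual as a function of the dual variable; it is the gradient of `dualPotential`. -/
noncomputable def dualGrad (ν : Fin N → ℝ) : Fin N → ℝ :=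
  fun i => (J *ᵥ (Jᵀ *ᵥ ν)) i + 2 * γ ^ 2 * Real.sinh (4 * α * ν i) - y i

/-- The convex potential of the dual flow, up to the factor `α`. -/
noncomputable def dualPotential (ν : Fin N → ℝ) : ℝ :=
  ∑ j, α * (Jᵀ *ᵥ ν) j ^ 2 / 2 +
    ∑ i, (γ ^ 2 / 2 * Real.cosh (4 * α * ν i) - α * y i * ν i)

theorem residual_paramsOfDual (ν : Fin N → ℝ) :
    residual J y (paramsOfDual J α γ ν) = dualGrad J y α γ ν := by
  funext i
  have h1 : Real.exp (4 * α * ν i) = Real.exp (2 * α * ν i) * Real.exp (2 * α * ν i) := by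
    rw [← Real.exp_add]; ring_nf
  have h2 : Real.exp (-(4 * α * ν i)) =
      Real.exp (-(2 * α * ν i)) * Real.exp (-(2 * α * ν i)) := by
    rw [← Real.exp_add]; ring_nf
  simp only [residual, paramsOfDual, dualGrad, Pi.sub_apply, Pi.add_apply, Pi.mul_apply,
    Real.sinh_eq, h1, h2]
  ring

theorem contDiff_mulVec {m n : ℕ} (A : Matrix (Fin m) (Fin n) ℝ) :
    ContDiff ℝ 1 (fun x : Fin n → ℝ => A *ᵥ x) :=
  (LinearMap.toContinuousLinearMap A.mulVecLin).contDiff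

theorem contDiff_dualGrad : ContDiff ℝ 1 (dualGrad J y α γ) := by
  have h := (contDiff_mulVec J).comp (contDiff_mulVec Jᵀ)
  rw [contDiff_pi] at h ⊢
  intro i
  have hi : ContDiff ℝ 1 fun ν : Fin N → ℝ => (J *ᵥ (Jᵀ *ᵥ ν)) i := h i
  unfold dualGrad
  fun_prop

theorem contDiff_direction : ContDiff ℝ 1 (direction J y α) := by
  have hJ : ContDiff ℝ 1 fun z : Params N p => J *ᵥ z.1 := (contDiff_mulVec J).comp contDiff_fst
  have hr : ContDiff ℝ 1 (residual J y) := by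
    unfold residual
    rw [contDiff_pi] at hJ ⊢
    intro i
    have := hJ i
    simp only [Pi.sub_apply, Pi.add_apply, Pi.mul_apply]
    fun_prop
  have hJr : ContDiff ℝ 1 fun z : Params N p => Jᵀ *ᵥ residual J y z :=
    (contDiff_mulVec Jᵀ).comp hr
  have hri : ∀ i, ContDiff ℝ 1 fun z : Params N p => residual J y z i := contDiff_pi.1 hr
  unfold direction negGrad
  refine hJr.neg.prodMk (ContDiff.prodMk ?_ ?_) <;>
  · rw [contDiff_pi]
    intro i
    have := hri i
    simp only [Pi.smul_apply, Pi.mul_apply]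
    fun_prop

variable {α γ}

/-- The function `sinh x - x` is increasing. This is the source of strong monotonicity. -/
theorem sinh_sub_sinh_mul_sub_ge (a b : ℝ) :
    (a - b) ^ 2 ≤ (Real.sinh a - Real.sinh b) * (a - b) := by
  rcases le_total a b with h | h <;>
  · have := Real.sinh_sub_id_strictMono.monotone h
    nlinarith

/-- The dual gradient is strongly monotone. -/
theorem dualGrad_strongly_monotone (hα : 0 < α) (a b : Fin N → ℝ) :
    8 * α * γ ^ 2 * ∑ i, (a i - b i) ^ 2 ≤
      ∑ i, (dualGrad J y α γ a i - dualGrad J y α γ b i) * (a i - b i) := by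
  have h1 : ∑ i, ((J *ᵥ (Jᵀ *ᵥ a)) i - (J *ᵥ (Jᵀ *ᵥ b)) i) * (a i - b i) =
      ∑ j, (Jᵀ *ᵥ (a - b)) j ^ 2 := by
    have : (J *ᵥ (Jᵀ *ᵥ (a - b))) ⬝ᵥ (a - b) = (Jᵀ *ᵥ (a - b)) ⬝ᵥ (Jᵀ *ᵥ (a - b)) := by
      rw [dotProduct_comm, Matrix.dotProduct_mulVec, ← Matrix.mulVec_transpose]
    simp only [mulVec_sub, dotProduct, Pi.sub_apply, ← pow_two] at this ⊢
    exact this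
  have h2 : ∀ i, 8 * α * γ ^ 2 * (a i - b i) ^ 2 ≤
      (2 * γ ^ 2 * Real.sinh (4 * α * a i) - 2 * γ ^ 2 * Real.sinh (4 * α * b i)) *
        (a i - b i) := by
    intro i
    have h := mul_le_mul_of_nonneg_left (sinh_sub_sinh_mul_sub_ge (4 * α * a i) (4 * α * b i))
      (by positivity : 0 ≤ 2 * γ ^ 2 / (4 * α))
    have e1 : 2 * γ ^ 2 / (4 * α) * (4 * α * a i - 4 * α * b i) ^ 2 =
      8 * α * γ ^ 2 * (a i - b i) ^ 2 := by field_simp; ring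
    have e2 : 2 * γ ^ 2 / (4 * α) * ((Real.sinh (4 * α * a i) - Real.sinh (4 * α * b i)) *
        (4 * α * a i - 4 * α * b i)) =
      (2 * γ ^ 2 * Real.sinh (4 * α * a i) - 2 * γ ^ 2 * Real.sinh (4 * α * b i)) *
        (a i - b i) := by field_simp
    rwa [e1, e2] at h
  calc _ ≤ ∑ j, (Jᵀ *ᵥ (a - b)) j ^ 2 + ∑ i, 8 * α * γ ^ 2 * (a i - b i) ^ 2 := by
        rw [Finset.mul_sum]
        exact le_add_of_nonneg_left (Finset.sum_nonneg fun _ _ => sq_nonneg _)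
    _ ≤ ∑ j, (Jᵀ *ᵥ (a - b)) j ^ 2 +
        ∑ i, (2 * γ ^ 2 * Real.sinh (4 * α * a i) - 2 * γ ^ 2 * Real.sinh (4 * α * b i)) *
        (a i - b i) := by gcongr ∑ j, _ + ∑ i, ?_; exact h2 _
    _ = _ := by
        rw [← h1, ← Finset.sum_add_distrib]
        exact Finset.sum_congr rfl fun i _ => by simp only [dualGrad]; ring

theorem hasDerivAt_dualPotential (ν : Fin N → ℝ) (i : Fin N) :
    HasDerivAt (fun t : ℝ => dualPotential J y α γ (ν + t • Pi.single i 1))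
      (α * dualGrad J y α γ ν i) 0 := by
  have h1 : ∀ j, HasDerivAt (fun t : ℝ => α * (Jᵀ *ᵥ (ν + t • Pi.single i 1)) j ^ 2 / 2)
      (α * (J i j * (Jᵀ *ᵥ ν) j)) 0 := by
    intro j
    have h : HasDerivAt (fun t : ℝ => (Jᵀ *ᵥ (ν + t • Pi.single i 1)) j) (J i j) 0 := by
      simp only [mulVec_add, mulVec_smul, Pi.add_apply, Pi.smul_apply, smul_eq_mul,
        mulVec_single_one, Matrix.col_apply, transpose_apply]
      simpa using ((hasDerivAt_id (0 : ℝ)).mul_const (J i j)).const_add ((Jᵀ *ᵥ ν) j)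
    refine (((h.pow 2).const_mul α).div_const 2).congr_deriv ?_
    simp
    ring
  have h2 : ∀ l, HasDerivAt (fun t : ℝ => γ ^ 2 / 2 *
      Real.cosh (4 * α * (ν l + t * (Pi.single i (1 : ℝ) : Fin N → ℝ) l)) -
        α * y l * (ν l + t * (Pi.single i (1 : ℝ) : Fin N → ℝ) l))
      ((α * (2 * γ ^ 2 * Real.sinh (4 * α * ν l) - y l)) * (Pi.single i (1 : ℝ) : Fin N → ℝ) l)
      0 := by
    intro l
    have h : HasDerivAt (fun t : ℝ => (ν l + t * (Pi.single i (1 : ℝ) : Fin N → ℝ) l))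
        ((Pi.single i (1 : ℝ) : Fin N → ℝ) l) 0 := by
      simpa using ((hasDerivAt_id (0 : ℝ)).mul_const
        ((Pi.single i (1 : ℝ) : Fin N → ℝ) l)).const_add (ν l)
    refine ((((h.const_mul (4 * α)).cosh).const_mul (γ ^ 2 / 2)).sub
      (h.const_mul (α * y l))).congr_deriv ?_
    simp
    ring
  refine ((HasDerivAt.fun_sum (u := Finset.univ) fun j _ => h1 j).add
    (HasDerivAt.fun_sum (u := Finset.univ) fun l _ => h2 l)).congr_deriv ?_
  have e : ∑ l, (α * (2 * γ ^ 2 * Real.sinh (4 * α * ν l) - y l)) *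
      (Pi.single i (1 : ℝ) : Fin N → ℝ) l =
      α * (2 * γ ^ 2 * Real.sinh (4 * α * ν i) - y i) := by
    simp [Pi.single_apply]
  have e' : (J *ᵥ (Jᵀ *ᵥ ν)) i = ∑ j, J i j * (Jᵀ *ᵥ ν) j := rfl
  rw [e, ← Finset.mul_sum]
  simp only [dualGrad, e']
  ring

theorem continuous_dualPotential : Continuous (dualPotential J y α γ) := by
  have h : ∀ j, Continuous fun ν : Fin N → ℝ => (Jᵀ *ᵥ ν) j := fun j =>
    (continuous_apply j).comp (contDiff_mulVec Jᵀ).continuous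
  unfold dualPotential
  refine Continuous.add (continuous_finsetSum _ fun j _ => ?_) (by fun_prop)
  have := h j
  fun_prop

/-- The dual gradient has a zero, since the dual potential is coercive. -/
theorem exists_dualGrad_eq_zero (hα : 0 < α) (hγ : 0 < γ) :
    ∃ ν : Fin N → ℝ, dualGrad J y α γ ν = 0 := by
  have hcosh : ∀ x : ℝ, x ^ 2 / 4 ≤ Real.cosh x := fun x => by
    rw [← Real.cosh_abs, Real.cosh_eq, ← sq_abs]
    linarith [Real.quadratic_le_exp_of_nonneg (abs_nonneg x), Real.add_one_le_exp (-|x|)]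
  -- The `cosh` term is at least `c ν²`; half of this absorbs the linear term by completing the
  -- square, at total cost `B`.
  set c := 2 * α ^ 2 * γ ^ 2 with hc
  have hc0 : 0 < c := by positivity
  set B := ∑ i, (α * y i) ^ 2 / (2 * c) with hB
  have hlow : ∀ ν i, c / 2 * ν i ^ 2 - B ≤ dualPotential J y α γ ν := by
    intro ν i
    have h1 : ∀ l, c / 2 * ν l ^ 2 - (α * y l) ^ 2 / (2 * c) ≤
        γ ^ 2 / 2 * Real.cosh (4 * α * ν l) - α * y l * ν l := by
      intro l
      have h2 := mul_le_mul_of_nonneg_left (hcosh (4 * α * ν l))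
        (by positivity : 0 ≤ γ ^ 2 / 2)
      have h3 : 0 ≤ c / 2 * (ν l - α * y l / c) ^ 2 := by positivity
      have h4 : c / 2 * (ν l - α * y l / c) ^ 2 =
          c / 2 * ν l ^ 2 - α * y l * ν l + (α * y l) ^ 2 / (2 * c) := by
        field_simp
        ring
      have h5 : γ ^ 2 / 2 * ((4 * α * ν l) ^ 2 / 4) = c * ν l ^ 2 := by rw [hc]; ring
      linarith
    have h2 : 0 ≤ ∑ j, α * (Jᵀ *ᵥ ν) j ^ 2 / 2 := Finset.sum_nonneg fun _ _ => by positivity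
    have h3 := Finset.sum_le_sum fun l (_ : l ∈ Finset.univ) => h1 l
    rw [Finset.sum_sub_distrib] at h3
    have h4 : c / 2 * ν i ^ 2 ≤ ∑ l, c / 2 * ν l ^ 2 :=
      Finset.single_le_sum (f := fun l => c / 2 * ν l ^ 2) (fun _ _ => by positivity)
        (Finset.mem_univ i)
    unfold dualPotential
    linarith
  have hev : ∀ᶠ ν in cocompact (Fin N → ℝ), dualPotential J y α γ 0 ≤ dualPotential J y α γ ν := by
    obtain ⟨ρ, hρ0, hρ⟩ : ∃ ρ : ℝ, 0 < ρ ∧ dualPotential J y α γ 0 + B ≤ c / 2 * ρ ^ 2 := by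
      refine ⟨|dualPotential J y α γ 0 + B| * (2 / c) + 1, by positivity, ?_⟩
      have : c / 2 * (|dualPotential J y α γ 0 + B| * (2 / c)) =
        |dualPotential J y α γ 0 + B| := by field_simp
      have h0 : 0 ≤ |dualPotential J y α γ 0 + B| * (2 / c) := by positivity
      have h1 : |dualPotential J y α γ 0 + B| * (2 / c) ≤
          (|dualPotential J y α γ 0 + B| * (2 / c) + 1) ^ 2 := by nlinarith
      have h2 := mul_le_mul_of_nonneg_left h1 (by positivity : 0 ≤ c / 2)
      linarith [le_abs_self (dualPotential J y α γ 0 + B)]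
    filter_upwards [(isCompact_closedBall (0 : Fin N → ℝ) ρ).compl_mem_cocompact] with ν hν
    rw [mem_compl_iff, mem_closedBall_zero_iff, pi_norm_le_iff_of_nonneg hρ0.le] at hν
    push Not at hν
    obtain ⟨i, hi⟩ := hν
    have h1 := hlow ν i
    have h2 : ρ ^ 2 ≤ ν i ^ 2 := by
      rw [← sq_abs (ν i)]
      exact pow_le_pow_left₀ hρ0.le hi.le 2
    have h3 := mul_le_mul_of_nonneg_left h2 (by positivity : 0 ≤ c / 2)
    linarith
  obtain ⟨ν, hν⟩ := (continuous_dualPotential J y).exists_forall_le' 0 hev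
  -- Fermat's rule on each coordinate line through the minimizer.
  refine ⟨ν, funext fun i => ?_⟩
  have hmin : IsLocalMin (fun t : ℝ => dualPotential J y α γ (ν + t • Pi.single i 1)) 0 :=
    Eventually.of_forall fun t => by simpa using hν _
  have := hmin.hasDerivAt_eq_zero (hasDerivAt_dualPotential J y ν i)
  simpa [hα.ne'] using this

/-- The dual gradient flow from the origin exists and converges to the zero of the dual
gradient. -/
theorem exists_dual_flow (hα : 0 < α) (hγ : 0 < γ) {νs : Fin N → ℝ}
    (hνs : dualGrad J y α γ νs = 0) :
    ∃ ν : ℝ → Fin N → ℝ, ν 0 = 0 ∧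
      (∀ t, 0 ≤ t → HasDerivWithinAt ν (-dualGrad J y α γ (ν t)) (Ici 0) t) ∧
      Tendsto ν atTop (𝓝 νs) := by
  set c := 8 * α * γ ^ 2 with hc
  have hc0 : 0 < c := by positivity
  -- Initial squared distance to `νs`, plus `1`, so that `ρ ≥ 1` and a squared distance at most `ρ`
  -- implies a distance at most `ρ`.
  set ρ := ∑ i, νs i ^ 2 + 1 with hρ
  have hsum0 : 0 ≤ ∑ i, νs i ^ 2 := Finset.sum_nonneg fun _ _ => sq_nonneg _
  have hρ0 : 1 ≤ ρ := by linarith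
  set R := ‖νs‖ + ρ with hR
  have hR0 : 0 ≤ R := by positivity
  -- Truncation makes the field globally bounded and Lipschitz; the barrier argument `hstay` shows
  -- that it is never active.
  let clamp : (Fin N → ℝ) → (Fin N → ℝ) := fun x i => max (-R) (min R (x i))
  have hclamp : ∀ x, clamp x ∈ closedBall (0 : Fin N → ℝ) R := fun x => by
    rw [mem_closedBall_zero_iff, pi_norm_le_iff_of_nonneg hR0]
    intro i
    rw [Real.norm_eq_abs, abs_le]
    exact ⟨le_max_left _ _, max_le (by linarith) (min_le_left _ _)⟩
  have hclampL : LipschitzWith 1 clamp := by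
    refine LipschitzWith.of_dist_le_mul fun a b => ?_
    rw [NNReal.coe_one, one_mul, dist_pi_le_iff dist_nonneg]
    intro i
    have h1 : |clamp a i - clamp b i| ≤ |min R (a i) - min R (b i)| := by
      simpa using abs_max_sub_max_le_max (-R) (min R (a i)) (-R) (min R (b i))
    have h2 : |min R (a i) - min R (b i)| ≤ |a i - b i| := by
      simpa using abs_min_sub_min_le_max R (a i) R (b i)
    exact (h1.trans h2).trans (dist_le_pi_dist a b i)
  have hclamp_id : ∀ x, ∑ i, (x i - νs i) ^ 2 ≤ ρ → clamp x = x := by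
    intro x hx
    funext i
    have h1 : (x i - νs i) ^ 2 ≤ ρ := (Finset.single_le_sum (f := fun i => (x i - νs i) ^ 2)
      (fun _ _ => sq_nonneg _) (Finset.mem_univ i)).trans hx
    have h2 : |x i - νs i| ≤ ρ := by
      refine abs_le_of_sq_le_sq (h1.trans ?_) (by linarith)
      nlinarith
    have h3 : |νs i| ≤ ‖νs‖ := norm_le_pi_norm νs i
    rw [abs_le] at h2 h3
    simp only [clamp]
    rw [min_eq_right (by linarith), max_eq_right (by linarith)]
  have hg : ContDiff ℝ 1 fun x => -dualGrad J y α γ x := (contDiff_dualGrad J y α γ).neg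
  obtain ⟨K, hK⟩ := lipschitzOn_balls_of_contDiff hg R
  obtain ⟨L, hL⟩ := (isCompact_closedBall (0 : Fin N → ℝ) R).exists_bound_of_continuousOn
    hg.continuous.continuousOn
  have hL0 : 0 ≤ L := (norm_nonneg _).trans (hL _ (hclamp 0))
  have hKc : LipschitzWith K fun x => -dualGrad J y α γ (clamp x) := by
    have := hK.comp (hclampL.lipschitzOnWith (s := univ)) fun x _ => hclamp x
    rw [mul_one, lipschitzOnWith_univ] at this
    exact this
  obtain ⟨ν, hν0, hν⟩ := exists_hasDerivWithinAt_Ici_of_bounded_lipschitz (L := ⟨L, hL0⟩) hKc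
    (fun x => hL _ (hclamp x)) 0
  have hder : ∀ t, 0 ≤ t → HasDerivWithinAt (fun t => ∑ i, (ν t i - νs i) ^ 2)
      (∑ i, 2 * (ν t i - νs i) * -dualGrad J y α γ (clamp (ν t)) i) (Ici 0) t := by
    intro t ht
    refine HasDerivWithinAt.fun_sum fun i _ => ?_
    have h := ((hasDerivWithinAt_pi.1 (hν t ht) i).sub_const (νs i)).pow 2
    refine h.congr_deriv ?_
    simp
  have hmon : ∀ x : Fin N → ℝ, ∑ i, 2 * (x i - νs i) * -dualGrad J y α γ x i ≤
      -(2 * c) * ∑ i, (x i - νs i) ^ 2 := by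
    intro x
    have h := dualGrad_strongly_monotone J y (γ := γ) hα x νs
    rw [hνs] at h
    have e : ∑ i, 2 * (x i - νs i) * -dualGrad J y α γ x i =
        -2 * ∑ i, (dualGrad J y α γ x i - (0 : Fin N → ℝ) i) * (x i - νs i) := by
      rw [Finset.mul_sum]
      exact Finset.sum_congr rfl fun i _ => by simp only [Pi.zero_apply]; ring
    rw [e]
    linarith
  -- If the squared distance reached `ρ`, the truncation would be the identity there and strong
  -- monotonicity would make the derivative negative.
  have hstay : ∀ t, 0 ≤ t → ∑ i, (ν t i - νs i) ^ 2 ≤ ρ := by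
    intro t ht
    refine image_le_of_deriv_right_lt_deriv_boundary' (a := 0) (b := t) (B := fun _ => ρ)
      (B' := fun _ => 0) (f := fun t => ∑ i, (ν t i - νs i) ^ 2)
      (fun s hs => ((hder s hs.1).mono Icc_subset_Ici_self).continuousWithinAt)
      (fun s hs => (hder s hs.1).mono (Ici_subset_Ici.2 hs.1)) ?_ continuousOn_const
      (fun s _ => hasDerivWithinAt_const _ _ _) ?_ ⟨ht, le_rfl⟩
    · simp [hν0, hρ]
    · intro s _ hs
      rw [hclamp_id _ hs.le]
      have h := hmon (ν s)
      rw [hs] at h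
      nlinarith
  refine ⟨ν, hν0, fun t ht => ?_, ?_⟩
  · have := hν t ht
    rwa [hclamp_id _ (hstay t ht)] at this
  have hdecay : ∀ t, 0 ≤ t →
      (∑ i, (ν t i - νs i) ^ 2) * Real.exp (2 * c * t) ≤ ρ := by
    intro t ht
    have hd : ∀ s, 0 ≤ s → HasDerivWithinAt
        (fun s => (∑ i, (ν s i - νs i) ^ 2) * Real.exp (2 * c * s))
        ((∑ i, 2 * (ν s i - νs i) * -dualGrad J y α γ (clamp (ν s)) i) * Real.exp (2 * c * s) +
          (∑ i, (ν s i - νs i) ^ 2) * (Real.exp (2 * c * s) * (2 * c))) (Ici 0) s := by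
      intro s hs
      have he : HasDerivAt (fun s => Real.exp (2 * c * s)) (Real.exp (2 * c * s) * (2 * c)) s := by
        simpa using ((hasDerivAt_id s).const_mul (2 * c)).exp
      exact (hder s hs).mul he.hasDerivWithinAt
    have hanti := antitoneOn_of_hasDerivWithinAt_nonpos (convex_Ici (0 : ℝ))
      (fun s hs => (hd s hs).continuousWithinAt)
      (fun s hs => (hd s (interior_subset hs)).mono interior_subset) (fun s hs => ?_)
    · have h := hanti (self_mem_Ici) ht ht
      simp only [mul_zero, Real.exp_zero, mul_one] at h
      refine h.trans ?_
      simp [hν0, hρ]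
    · rw [hclamp_id _ (hstay s (interior_subset hs))]
      nlinarith [hmon (ν s), Real.exp_pos (2 * c * s)]
  have hlim : Tendsto (fun t => ρ * Real.exp (-(2 * c * t))) atTop (𝓝 0) := by
    have h1 : Tendsto (fun t : ℝ => 2 * c * t) atTop atTop :=
      tendsto_id.const_mul_atTop (by positivity)
    simpa using (Real.tendsto_exp_neg_atTop_nhds_zero.comp h1).const_mul ρ
  rw [tendsto_pi_nhds]
  intro i
  rw [tendsto_iff_norm_sub_tendsto_zero]
  have hsq : Tendsto (fun t => (ν t i - νs i) ^ 2) atTop (𝓝 0) := by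
    refine squeeze_zero' (Eventually.of_forall fun _ => sq_nonneg _) ?_ hlim
    filter_upwards [eventually_ge_atTop 0] with t ht
    have h1 := Finset.single_le_sum (f := fun i => (ν t i - νs i) ^ 2)
      (fun _ _ => sq_nonneg _) (Finset.mem_univ i)
    refine h1.trans ?_
    rw [Real.exp_neg, ← div_eq_mul_inv, le_div_iff₀ (Real.exp_pos _)]
    exact hdecay t ht
  have := hsq.sqrt
  simpa [Real.sqrt_sq_eq_abs] using this

/-- The field is `C¹`, hence Lipschitz on balls, so uniqueness and Euler convergence apply to any
solution. -/
theorem isLimitDynamics_of_isGradientFlow {z : ℝ → Params N p} (hz : IsGradientFlow J y α γ z) :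
    IsLimitDynamics J y α γ z := by
  have hL := lipschitzOn_balls_of_contDiff (contDiff_direction J y α)
  refine ⟨hz, fun z' hz' t ht => ?_, fun t ht => ?_⟩
  · exact eqOn_of_hasDerivWithinAt_of_lipschitzOn_balls (T := t) hL
      (fun s hs => (hz'.2 s hs.1).mono Icc_subset_Ici_self)
      (fun s hs => (hz.2 s hs.1).mono Icc_subset_Ici_self) (hz'.1.trans hz.1.symm) ⟨ht, le_rfl⟩
  · exact tendsto_euler hL hz.2 (fun τ => hz.1.symm) (fun τ n => rfl) ht

/-- The gradient flow of the over-parameterized problem converges, and its limit is described by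
the zero of the dual gradient. -/
theorem exists_isLimitDynamics_tendsto (hα : 0 < α) (hγ : 0 < γ) {νs : Fin N → ℝ}
    (hνs : dualGrad J y α γ νs = 0) :
    ∃ z : ℝ → Params N p, IsLimitDynamics J y α γ z ∧
      Tendsto z atTop (𝓝 (paramsOfDual J α γ νs)) := by
  obtain ⟨ν, hν0, hν, hlim⟩ := exists_dual_flow J y hα hγ hνs
  have hcont : Continuous (paramsOfDual J α γ) := by
    unfold paramsOfDual
    exact (contDiff_mulVec Jᵀ).continuous.prodMk (by fun_prop)
  refine ⟨fun t => paramsOfDual J α γ (ν t), isLimitDynamics_of_isGradientFlow J y ⟨?_, ?_⟩,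
    (hcont.tendsto νs).comp hlim⟩
  · simp [paramsOfDual, initial, hν0]
  · intro t ht
    have hi := fun i => hasDerivWithinAt_pi.1 (hν t ht) i
    have h1 : HasDerivWithinAt (fun t => Jᵀ *ᵥ ν t) (-(Jᵀ *ᵥ dualGrad J y α γ (ν t)))
        (Ici 0) t := by
      have := (LinearMap.toContinuousLinearMap Jᵀ.mulVecLin).hasFDerivAt.comp_hasDerivWithinAt t
        (hν t ht)
      rw [← mulVec_neg]
      exact this
    unfold direction negGrad
    rw [residual_paramsOfDual]
    refine h1.prodMk (HasDerivWithinAt.prodMk ?_ ?_)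
    · rw [hasDerivWithinAt_pi]
      intro i
      refine ((((hi i).const_mul (2 * α)).exp).const_mul γ).congr_deriv ?_
      simp [paramsOfDual]
      ring
    · rw [hasDerivWithinAt_pi]
      intro i
      refine (((((hi i).const_mul (2 * α)).fun_neg).exp).const_mul γ).congr_deriv ?_
      simp [paramsOfDual]
      ring

end DualFlow

/-! ### Incoherence and the dual certificate -/

section Certificate

variable {N p r : ℕ}

/-- The rows of the left singular vectors of an incoherent matrix are short. -/
theorem sum_sq_row_le_of_coherence_le {U : Matrix (Fin N) (Fin r) ℝ} {μ : ℝ}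
    (h : coherence U ≤ μ) (i : Fin N) : ∑ a, U i a ^ 2 ≤ μ * r / N := by
  have hN : (0 : ℝ) < N := by exact_mod_cast i.pos
  rcases Nat.eq_zero_or_pos r with rfl | hr
  · simp
  have hr' : (0 : ℝ) < r := by exact_mod_cast hr
  have h1 : sqNorm (Uᵀ *ᵥ (Pi.single i (1 : ℝ))) ≤
      ⨆ i : Fin N, sqNorm (Uᵀ *ᵥ (Pi.single i (1 : ℝ))) :=
    le_ciSup (f := fun i : Fin N => sqNorm (Uᵀ *ᵥ (Pi.single i (1 : ℝ))))
      (Set.finite_range _).bddAbove i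
  have h2 : sqNorm (Uᵀ *ᵥ (Pi.single i (1 : ℝ))) = ∑ a, U i a ^ 2 := by
    simp [sqNorm]
  rw [← h2, le_div_iff₀ hN]
  have h3 := mul_le_mul_of_nonneg_left h1 (by positivity : 0 ≤ (N : ℝ) / r)
  have h4 := h3.trans h
  rw [div_mul_eq_mul_div, div_le_iff₀ hr'] at h4
  linarith

/-- The entry is the inner product of two rows, bounded by `|ab| ≤ (a² + b²) / 2`. -/
theorem abs_mul_transpose_apply_le {U : Matrix (Fin N) (Fin r) ℝ} {η : ℝ}
    (h : ∀ i, ∑ a, U i a ^ 2 ≤ η) (i j : Fin N) : |(U * Uᵀ) i j| ≤ η := by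
  have h1 : ∑ a, |U i a * U j a| ≤ ∑ a, (U i a ^ 2 + U j a ^ 2) / 2 := by
    gcongr with a
    rw [abs_mul, ← sq_abs (U i a), ← sq_abs (U j a)]
    linarith [two_mul_le_add_sq |U i a| |U j a|]
  rw [← Finset.sum_div, Finset.sum_add_distrib] at h1
  calc |(U * Uᵀ) i j| = |∑ a, U i a * U j a| := by rw [Matrix.mul_apply]; rfl
    _ ≤ ∑ a, |U i a * U j a| := Finset.abs_sum_le_sum_abs _ _
    _ ≤ η := by linarith [h i, h j]

/-- For an entrywise small matrix `P`, the vectors `c - P c` with `c` supported on a small set `S`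
interpolate arbitrary values on `S` and are small outside of `S`. -/
theorem exists_sub_mulVec_interpolating {P : Matrix (Fin N) (Fin N) ℝ} {η : ℝ} {S : Finset (Fin N)}
    (hP : ∀ i j, |P i j| ≤ η) (hS : S.card * η ≤ 1 / 4) (b : Fin N → ℝ) :
    ∃ c : Fin N → ℝ, (∀ i ∈ S, (c - P *ᵥ c) i = b i) ∧
      ∀ i, i ∉ S → |(c - P *ᵥ c) i| ≤ ‖b‖ / 3 := by
  let D : Matrix (Fin N) (Fin N) ℝ := Matrix.diagonal fun j => if j ∈ S then 1 else 0
  have hD : ∀ a j, (D *ᵥ a) j = if j ∈ S then a j else 0 := fun a j => by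
    simp [D, Matrix.mulVec_diagonal]
  have hsmall : ∀ a i, |(P *ᵥ (D *ᵥ a)) i| ≤ ‖a‖ / 4 := by
    intro a i
    have e : (P *ᵥ (D *ᵥ a)) i = ∑ j ∈ S, P i j * a j := by
      simp [mulVec, dotProduct, D, Matrix.diagonal_apply]
    rw [e]
    calc |∑ j ∈ S, P i j * a j| ≤ ∑ j ∈ S, |P i j * a j| := Finset.abs_sum_le_sum_abs _ _
      _ ≤ ∑ _j ∈ S, η * ‖a‖ := by
          gcongr with j
          rw [abs_mul]
          exact mul_le_mul (hP i j) (norm_le_pi_norm a j) (abs_nonneg _)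
            ((abs_nonneg _).trans (hP i j))
      _ = S.card * η * ‖a‖ := by rw [Finset.sum_const, nsmul_eq_mul]; ring
      _ ≤ 1 / 4 * ‖a‖ := by gcongr
      _ = _ := by ring
  -- Since `P D` has sup-norm at most `1/4`, `T` is invertible and `‖a‖ ≤ (4/3) ‖T a‖`; the bound
  -- `‖b‖ / 3` off `S` is a quarter of this.
  let T : (Fin N → ℝ) →ₗ[ℝ] (Fin N → ℝ) := LinearMap.id - P.mulVecLin ∘ₗ D.mulVecLin
  have hT : ∀ a, T a = a - P *ᵥ (D *ᵥ a) := fun a => rfl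
  have hnorm : ∀ a, ‖a‖ ≤ ‖T a‖ + ‖a‖ / 4 := by
    intro a
    have h1 : ‖P *ᵥ (D *ᵥ a)‖ ≤ ‖a‖ / 4 :=
      (pi_norm_le_iff_of_nonneg (by positivity)).2 (hsmall a)
    have h2 := norm_add_le (T a) (P *ᵥ (D *ᵥ a))
    rw [hT, sub_add_cancel] at h2
    rw [hT]
    linarith
  have hinj : Function.Injective T := by
    rw [injective_iff_map_eq_zero]
    intro a ha
    have h := hnorm a
    rw [ha, norm_zero] at h
    exact norm_le_zero_iff.1 (by linarith)
  obtain ⟨a, ha⟩ := LinearMap.injective_iff_surjective.1 hinj b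
  have hab := hnorm a
  rw [ha] at hab
  rw [hT] at ha
  refine ⟨D *ᵥ a, fun i hi => ?_, fun i hi => ?_⟩
  · rw [← ha, Pi.sub_apply, Pi.sub_apply, hD, if_pos hi]
  · rw [Pi.sub_apply, hD, if_neg hi, zero_sub, abs_neg]
    linarith [hsmall a i]

/-- The minimal norm solution lies in the range of `Jᵀ`. -/
theorem exists_transpose_mulVec_eq_of_isMinNormSolution {J : Matrix (Fin N) (Fin p) ℝ}
    {U : Matrix (Fin N) (Fin r) ℝ} {σ : Fin r → ℝ} {V : Matrix (Fin p) (Fin r) ℝ}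
    (hJ : IsCompactSVD J U σ V) {s y : Fin N → ℝ} {θ : Fin p → ℝ}
    (hθ : IsMinNormSolution J s y θ) : ∃ ν : Fin N → ℝ, Jᵀ *ᵥ ν = θ := by
  have hJV : J * (V * Vᵀ) = J := by
    rw [hJ.eq, Matrix.mul_assoc, ← Matrix.mul_assoc Vᵀ V, hJ.orth_right, Matrix.one_mul]
  have hidem : (V * Vᵀ) * (V * Vᵀ) = V * Vᵀ := by
    rw [Matrix.mul_assoc, ← Matrix.mul_assoc Vᵀ V, hJ.orth_right, Matrix.one_mul]
  have hsymm : (V * Vᵀ)ᵀ = V * Vᵀ := by simp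
  have hle : sqNorm θ ≤ sqNorm ((V * Vᵀ) *ᵥ θ) :=
    hθ.2 _ (by rw [mulVec_mulVec, hJV]; exact hθ.1)
  have hdot : (V * Vᵀ) *ᵥ θ ⬝ᵥ (θ - (V * Vᵀ) *ᵥ θ) = 0 := by
    rw [dotProduct_comm, Matrix.dotProduct_mulVec, ← Matrix.mulVec_transpose, hsymm, mulVec_sub,
      mulVec_mulVec, hidem, sub_self, zero_dotProduct]
  have heq : (V * Vᵀ) *ᵥ θ = θ := by
    set q := (V * Vᵀ) *ᵥ θ with hq
    have h1 : ∑ i, (θ i - q i) ^ 2 + 2 * (q ⬝ᵥ (θ - q)) = sqNorm θ - sqNorm q := by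
      simp only [sqNorm, dotProduct, Finset.mul_sum, ← Finset.sum_add_distrib,
        ← Finset.sum_sub_distrib, Pi.sub_apply]
      exact Finset.sum_congr rfl fun i _ => by ring
    rw [hdot] at h1
    have h2 : ∑ i, (θ i - q i) ^ 2 = 0 :=
      le_antisymm (by linarith) (Finset.sum_nonneg fun _ _ => sq_nonneg _)
    funext i
    have h3 := (Finset.sum_eq_zero_iff_of_nonneg fun _ _ => sq_nonneg _).1 h2 i (Finset.mem_univ i)
    linarith [pow_eq_zero_iff two_ne_zero |>.1 h3]
  -- The pseudo-inverse of `Jᵀ` applied to `θ`.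
  refine ⟨(U * Matrix.diagonal (fun a => (σ a)⁻¹) * Vᵀ) *ᵥ θ, ?_⟩
  have hσ : Matrix.diagonal σ * Matrix.diagonal (fun a => (σ a)⁻¹) = 1 := by
    rw [Matrix.diagonal_mul_diagonal, ← Matrix.diagonal_one]
    congr 1
    funext a
    exact mul_inv_cancel₀ (hJ.pos a).ne'
  have hmul : Jᵀ * (U * Matrix.diagonal (fun a => (σ a)⁻¹) * Vᵀ) = V * Vᵀ := by
    rw [hJ.eq]
    simp only [Matrix.transpose_mul, Matrix.transpose_transpose, Matrix.diagonal_transpose]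
    calc V * (diagonal σ * Uᵀ) * (U * diagonal (fun a => (σ a)⁻¹) * Vᵀ)
        = V * (diagonal σ * ((Uᵀ * U) * diagonal (fun a => (σ a)⁻¹))) * Vᵀ := by
          simp only [Matrix.mul_assoc]
      _ = V * Vᵀ := by rw [hJ.orth_left, Matrix.one_mul, hσ, Matrix.mul_one]
  rw [mulVec_mulVec, hmul, heq]

/-- The dual certificate for the exact recovery of a sparse vector under incoherence. -/
theorem exists_dual_certificate {J : Matrix (Fin N) (Fin p) ℝ} {μ : ℝ} {k : ℕ}
    (hJ : IsIncoherent J r μ) (hk : (k : ℝ) ^ 2 * r < N / (4 * μ)) {s : Fin N → ℝ}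
    (hs : IsSparse k s) {ν₀ : Fin N → ℝ} {lam : ℝ} (hlam : 2 * ‖ν₀‖ < lam) :
    ∃ ν : Fin N → ℝ, Jᵀ *ᵥ ν = Jᵀ *ᵥ ν₀ ∧ (∀ i, s i ≠ 0 → ν i = lam * Real.sign (s i)) ∧
      ∀ i, s i = 0 → |ν i| < lam := by
  obtain ⟨U, σ, V, hsvd, hcoh⟩ := hJ
  have hrow := sum_sq_row_le_of_coherence_le hcoh
  have hP := abs_mul_transpose_apply_le hrow
  set S := Finset.univ.filter fun i => s i ≠ 0 with hS
  -- Positivity of the quotient forces `N` and `μ` to be positive.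
  have hpos : 0 < (N : ℝ) / (4 * μ) := lt_of_le_of_lt (by positivity) hk
  have hN : (0 : ℝ) < N := by
    rcases (Nat.cast_nonneg N : (0 : ℝ) ≤ N).eq_or_lt with h | h
    · rw [← h] at hpos; simp at hpos
    · exact h
  have hμ : 0 < μ := by
    have := (div_pos_iff_of_pos_left hN).1 hpos
    linarith
  have hcard : S.card * (μ * r / N) ≤ 1 / 4 := by
    have h1 : (S.card : ℝ) ≤ k := by exact_mod_cast hs
    have h2 : (k : ℝ) ≤ (k : ℝ) ^ 2 := by exact_mod_cast Nat.le_self_pow two_ne_zero k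
    rw [lt_div_iff₀ (by positivity)] at hk
    rw [← mul_div_assoc, div_le_iff₀ hN]
    have h3 : (S.card : ℝ) * (μ * r) ≤ (k : ℝ) ^ 2 * (μ * r) := by
      gcongr
      exact h1.trans h2
    linarith
  set b : Fin N → ℝ := fun i => lam * Real.sign (s i) - ν₀ i with hb
  have hlam0 : 0 < lam := lt_of_le_of_lt (by positivity) hlam
  have hbn : ‖b‖ ≤ lam + ‖ν₀‖ := by
    rw [pi_norm_le_iff_of_nonneg (by positivity)]
    intro i
    refine (norm_sub_le _ _).trans (add_le_add ?_ (norm_le_pi_norm ν₀ i))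
    rw [Real.norm_eq_abs, abs_mul, abs_of_pos hlam0]
    rcases Real.sign_apply_eq (s i) with h | h | h <;> simp [h, hlam0.le]
  obtain ⟨c, hc, hc'⟩ := exists_sub_mulVec_interpolating hP hcard b
  have hker : Jᵀ *ᵥ (c - (U * Uᵀ) *ᵥ c) = 0 := by
    have : Jᵀ * (U * Uᵀ) = Jᵀ := by
      rw [hsvd.eq]
      simp only [Matrix.transpose_mul, Matrix.transpose_transpose, Matrix.mul_assoc]
      rw [← Matrix.mul_assoc Uᵀ U, hsvd.orth_left, Matrix.one_mul]
    rw [mulVec_sub, mulVec_mulVec, this, sub_self]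
  refine ⟨ν₀ + (c - (U * Uᵀ) *ᵥ c), by rw [mulVec_add, hker, add_zero], fun i hi => ?_,
    fun i hi => ?_⟩
  · rw [Pi.add_apply, hc i (by simp [hS, hi])]
    simp [hb]
  · have h1 := hc' i (by simp [hS, hi])
    have h2 : |ν₀ i| ≤ ‖ν₀‖ := norm_le_pi_norm ν₀ i
    rw [Pi.add_apply]
    refine (abs_add_le _ _).trans_lt ?_
    -- `‖ν₀‖ + (lam + ‖ν₀‖) / 3 < lam` is exactly `2 ‖ν₀‖ < lam`.
    linarith

end Certificate

/-! ### Asymptotics of small initialization -/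

section SmallInitialization

variable {N p : ℕ}

/-- The slope `4 α` of the argument of `sinh` for `α = -log γ / (2 lam)`. -/
noncomputable def sinhRate (lam γ : ℝ) : ℝ := 4 * (-Real.log γ / (2 * lam))

theorem sinhRate_pos {lam γ : ℝ} (hlam : 0 < lam) (h0 : 0 < γ) (h1 : γ < 1) :
    0 < sinhRate lam γ := by
  have := Real.log_neg h0 h1
  unfold sinhRate
  have : 0 < -Real.log γ := by linarith
  positivity

theorem eventually_mem_Ioo_zero_one : ∀ᶠ γ : ℝ in 𝓝[>] 0, 0 < γ ∧ γ < 1 :=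
  (Ioo_mem_nhdsGT zero_lt_one : Set.Ioo (0 : ℝ) 1 ∈ 𝓝[>] 0)

/-- Below the level `lam` the function `2 γ² sinh` is asymptotically negligible. -/
theorem tendsto_two_mul_sq_mul_sinh {lam c : ℝ} (hlam : 0 < lam) (hc : 0 ≤ c) (hcl : c < lam) :
    Tendsto (fun γ => 2 * γ ^ 2 * Real.sinh (sinhRate lam γ * c)) (𝓝[>] 0) (𝓝 0) := by
  have hlim : Tendsto (fun γ => Real.exp (Real.log γ * (2 * (1 - c / lam)))) (𝓝[>] 0) (𝓝 0) := by
    have h : 0 < 2 * (1 - c / lam) := by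
      have : c / lam < 1 := (div_lt_one hlam).2 hcl
      linarith
    exact Real.tendsto_exp_atBot.comp (Real.tendsto_log_nhdsGT_zero.atBot_mul_const h)
  refine squeeze_zero' ?_ ?_ hlim
  · filter_upwards [eventually_mem_Ioo_zero_one] with γ hγ
    have := sinhRate_pos hlam hγ.1 hγ.2
    have := Real.sinh_nonneg_iff.2 (mul_nonneg this.le hc)
    positivity
  · filter_upwards [eventually_mem_Ioo_zero_one] with γ hγ
    have e : Real.exp (Real.log γ * (2 * (1 - c / lam))) =
        γ ^ 2 * Real.exp (sinhRate lam γ * c) := by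
      have : Real.log γ * (2 * (1 - c / lam)) =
          Real.log γ + Real.log γ + sinhRate lam γ * c := by
        unfold sinhRate
        field_simp
        ring
      rw [this, Real.exp_add, Real.exp_add, Real.exp_log hγ.1]
      ring
    rw [e, Real.sinh_eq]
    nlinarith [mul_pos (pow_pos hγ.1 2) (Real.exp_pos (-(sinhRate lam γ * c)))]

theorem log_two_mul_le_arsinh {t : ℝ} (ht : 0 < t) : Real.log (2 * t) ≤ Real.arsinh t := by
  unfold Real.arsinh
  refine Real.log_le_log (by positivity) ?_
  have : t ≤ √(1 + t ^ 2) := Real.le_sqrt_of_sq_le (by linarith)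
  linarith

theorem arsinh_le_log_two_mul_add_one {t : ℝ} (ht : 0 < t) :
    Real.arsinh t ≤ Real.log (2 * t + 1) := by
  unfold Real.arsinh
  have h : √(1 + t ^ 2) ≤ 1 + t := by
    rw [Real.sqrt_le_left (by positivity)]
    nlinarith
  refine Real.log_le_log (by positivity) (by linarith)

/-- The quotient is the solution `x` of `2γ² sinh(4αx) = s`. Up to bounded terms `arsinh` is a
logarithm, so the numerator is `-2 log γ + O(1)` against a rate of `-2 log γ / lam`. -/
theorem tendsto_arsinh_div_sinhRate_of_pos {lam s : ℝ} (hlam : 0 < lam) (hs : 0 < s) :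
    Tendsto (fun γ => Real.arsinh (s / (2 * γ ^ 2)) / sinhRate lam γ) (𝓝[>] 0) (𝓝 lam) := by
  have hlim : ∀ C : ℝ, Tendsto (fun γ => lam + lam * C / 2 * (-Real.log γ)⁻¹) (𝓝[>] 0)
      (𝓝 lam) := by
    intro C
    have h1 : Tendsto (fun γ => (-Real.log γ)⁻¹) (𝓝[>] 0) (𝓝 0) :=
      tendsto_inv_atTop_zero.comp (tendsto_neg_atBot_atTop.comp Real.tendsto_log_nhdsGT_zero)
    simpa using (h1.const_mul (lam * C / 2)).const_add lam
  have hform : ∀ γ C : ℝ, 0 < γ → γ < 1 →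
      lam + lam * C / 2 * (-Real.log γ)⁻¹ = (C - 2 * Real.log γ) / sinhRate lam γ := by
    intro γ C h0 h1
    have := (Real.log_neg h0 h1).ne
    unfold sinhRate
    field_simp
    ring
  refine tendsto_of_tendsto_of_tendsto_of_le_of_le' (hlim (Real.log s)) (hlim (Real.log (s + 1)))
    ?_ ?_
  · filter_upwards [eventually_mem_Ioo_zero_one] with γ hγ
    have hβ := sinhRate_pos hlam hγ.1 hγ.2
    have hγ0 := hγ.1
    rw [hform γ _ hγ.1 hγ.2]
    gcongr
    refine le_trans (le_of_eq ?_) (log_two_mul_le_arsinh (by positivity))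
    rw [show 2 * (s / (2 * γ ^ 2)) = s / γ ^ 2 by field_simp,
      Real.log_div hs.ne' (by positivity), Real.log_pow]
    norm_num
  · filter_upwards [eventually_mem_Ioo_zero_one] with γ hγ
    have hβ := sinhRate_pos hlam hγ.1 hγ.2
    have hγ0 := hγ.1
    rw [hform γ _ hγ.1 hγ.2]
    gcongr
    refine (arsinh_le_log_two_mul_add_one (by positivity)).trans ?_
    have e : Real.log (s + 1) - 2 * Real.log γ = Real.log ((s + 1) / γ ^ 2) := by
      rw [Real.log_div (by positivity) (by positivity), Real.log_pow]
      norm_num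
    rw [e]
    refine Real.log_le_log (by positivity) ?_
    rw [show 2 * (s / (2 * γ ^ 2)) + 1 = (s + γ ^ 2) / γ ^ 2 by field_simp]
    gcongr
    nlinarith [hγ.2]

theorem tendsto_arsinh_div_sinhRate {lam s : ℝ} (hlam : 0 < lam) (hs : s ≠ 0) :
    Tendsto (fun γ => Real.arsinh (s / (2 * γ ^ 2)) / sinhRate lam γ) (𝓝[>] 0)
      (𝓝 (lam * Real.sign s)) := by
  rcases hs.lt_or_gt with h | h
  · have := (tendsto_arsinh_div_sinhRate_of_pos hlam (neg_pos.2 h)).neg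
    simpa [Real.sign_of_neg h, neg_div, Real.arsinh_neg] using this
  · simpa [Real.sign_of_pos h] using tendsto_arsinh_div_sinhRate_of_pos hlam h

/-- Approximate monotonicity of `2 γ² sinh` along a certificate value `ν`. -/
theorem exists_error_bounds {lam s ν : ℝ} (hlam : 0 < lam)
    (hν : s ≠ 0 → ν = lam * Real.sign s) (hν' : s = 0 → |ν| < lam) :
    ∃ ε δ : ℝ → ℝ, Tendsto ε (𝓝[>] 0) (𝓝 0) ∧ Tendsto δ (𝓝[>] 0) (𝓝 0) ∧ (∀ γ, 0 ≤ ε γ) ∧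
      ∀ γ, 0 < γ → γ < 1 → ∀ x, -(ε γ * |2 * γ ^ 2 * Real.sinh (sinhRate lam γ * x) - s| + δ γ) ≤
        (x - ν) * (2 * γ ^ 2 * Real.sinh (sinhRate lam γ * x) - s) := by
  by_cases hs : s = 0
  · subst hs
    have h := hν' rfl
    refine ⟨fun _ => 0, fun γ => 2 * |ν| * (2 * γ ^ 2 * Real.sinh (sinhRate lam γ * |ν|)),
      tendsto_const_nhds, ?_, fun _ => le_rfl, ?_⟩
    · simpa using (tendsto_two_mul_sq_mul_sinh hlam (abs_nonneg ν) h).const_mul (2 * |ν|)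
    · intro γ h0 h1 x
      have hβ := sinhRate_pos hlam h0 h1
      simp only [zero_mul, zero_add, sub_zero]
      set β := sinhRate lam γ
      have hsν : 0 ≤ Real.sinh (β * |ν|) :=
        Real.sinh_nonneg_iff.2 (mul_nonneg hβ.le (abs_nonneg ν))
      -- For `|x| ≥ |ν|` both factors have the sign of `x`; otherwise the `sinh` factor is
      -- negligible because `|ν| < lam`.
      rcases le_total |ν| |x| with hx | hx
      · refine (neg_nonpos.2 (by positivity)).trans ?_
        rcases le_total 0 x with hx0 | hx0
        · rw [abs_of_nonneg hx0] at hx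
          have h2 := Real.sinh_nonneg_iff.2 (mul_nonneg hβ.le hx0)
          have h3 : 0 ≤ x - ν := by linarith [le_abs_self ν]
          positivity
        · rw [abs_of_nonpos hx0] at hx
          have h2 := Real.sinh_nonpos_iff.2 (mul_nonpos_of_nonneg_of_nonpos hβ.le hx0)
          have h3 : x - ν ≤ 0 := by linarith [neg_abs_le ν]
          exact mul_nonneg_of_nonpos_of_nonpos h3
            (mul_nonpos_of_nonneg_of_nonpos (by positivity) h2)
      · have h2 : |x - ν| ≤ 2 * |ν| := (abs_sub x ν).trans (by linarith)
        have h3 : |2 * γ ^ 2 * Real.sinh (β * x)| ≤ 2 * γ ^ 2 * Real.sinh (β * |ν|) := by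
          rw [abs_mul, abs_of_pos (by positivity : 0 < 2 * γ ^ 2), Real.abs_sinh, abs_mul,
            abs_of_pos hβ]
          gcongr
          exact Real.sinh_le_sinh.2 (by gcongr)
        refine (neg_le_neg ?_).trans (neg_abs_le _)
        rw [abs_mul]
        gcongr
  · refine ⟨fun γ => |Real.arsinh (s / (2 * γ ^ 2)) / sinhRate lam γ - ν|, fun _ => 0, ?_,
      tendsto_const_nhds, fun _ => abs_nonneg _, ?_⟩
    · have := ((tendsto_arsinh_div_sinhRate hlam hs).sub_const ν).abs
      simpa [hν hs] using this
    · intro γ h0 h1 x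
      have hβ := sinhRate_pos hlam h0 h1
      set β := sinhRate lam γ
      -- With the exact preimage `x₀` of `s` in place of `ν` the product is nonnegative; the
      -- replacement costs `|x₀ - ν|`, which tends to `0`.
      set x₀ := Real.arsinh (s / (2 * γ ^ 2)) / β with hx₀
      have hsx₀ : 2 * γ ^ 2 * Real.sinh (β * x₀) = s := by
        rw [hx₀, mul_div_cancel₀ _ hβ.ne', Real.sinh_arsinh]
        field_simp
      have hmono : 0 ≤ (x - x₀) * (2 * γ ^ 2 * Real.sinh (β * x) - s) := by
        have h2 := (sq_nonneg _).trans (sinh_sub_sinh_mul_sub_ge (β * x) (β * x₀))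
        have h3 : 0 ≤ β * ((x - x₀) * (2 * γ ^ 2 * Real.sinh (β * x) - s)) := by
          have : β * ((x - x₀) * (2 * γ ^ 2 * Real.sinh (β * x) - s)) = 2 * γ ^ 2 *
              ((Real.sinh (β * x) - Real.sinh (β * x₀)) * (β * x - β * x₀)) := by
            rw [← hsx₀]; ring
          rw [this]
          positivity
        exact nonneg_of_mul_nonneg_right h3 hβ
      have h4 := neg_abs_le ((x₀ - ν) * (2 * γ ^ 2 * Real.sinh (β * x) - s))
      rw [abs_mul] at h4
      have h5 : (x - ν) * (2 * γ ^ 2 * Real.sinh (β * x) - s) =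
        (x - x₀) * (2 * γ ^ 2 * Real.sinh (β * x) - s) +
          (x₀ - ν) * (2 * γ ^ 2 * Real.sinh (β * x) - s) := by ring
      linarith

/-- In the presence of a dual certificate the zeros of the dual gradient recover `θ` in the limit
of small initialization. -/
theorem tendsto_transpose_mulVec_of_certificate {J : Matrix (Fin N) (Fin p) ℝ} {lam : ℝ}
    (hlam : 0 < lam) {s νc : Fin N → ℝ} (hν : ∀ i, s i ≠ 0 → νc i = lam * Real.sign (s i))
    (hν' : ∀ i, s i = 0 → |νc i| < lam) {ν : ℝ → Fin N → ℝ}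
    (hzero : ∀ γ, 0 < γ → γ < 1 →
      dualGrad J (J *ᵥ (Jᵀ *ᵥ νc) + s) (-Real.log γ / (2 * lam)) γ (ν γ) = 0) :
    Tendsto (fun γ => Jᵀ *ᵥ ν γ) (𝓝[>] 0) (𝓝 (Jᵀ *ᵥ νc)) := by
  choose ε δ hε hδ hε0 hbound using fun i => exists_error_bounds hlam (hν i) (hν' i)
  set C : Fin N → ℝ := fun i => √(∑ j, J i j ^ 2) with hC
  set D : ℝ → ℝ := fun γ => ∑ j, (Jᵀ *ᵥ (ν γ - νc)) j ^ 2 with hD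
  have hD0 : ∀ γ, 0 ≤ D γ := fun γ => Finset.sum_nonneg fun _ _ => sq_nonneg _
  set E : ℝ → ℝ := fun γ => ∑ i, ε i γ * C i with hE
  set Δ : ℝ → ℝ := fun γ => ∑ i, δ i γ with hΔ
  have hE0 : Tendsto E (𝓝[>] 0) (𝓝 0) := by
    have := tendsto_finsetSum Finset.univ fun i (_ : i ∈ Finset.univ) => (hε i).mul_const (C i)
    simpa using this
  have hΔ0 : Tendsto Δ (𝓝[>] 0) (𝓝 0) := by
    have := tendsto_finsetSum Finset.univ fun i (_ : i ∈ Finset.univ) => hδ i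
    simpa using this
  have hmain : ∀ γ, 0 < γ → γ < 1 → D γ ≤ E γ ^ 2 + 2 * Δ γ := by
    intro γ h0 h1
    set sγ : Fin N → ℝ := fun i => 2 * γ ^ 2 * Real.sinh (sinhRate lam γ * ν γ i) with hsγ
    have hres : ∀ i, sγ i - s i = -(J *ᵥ (Jᵀ *ᵥ (ν γ - νc))) i := by
      intro i
      have h := congrFun (hzero γ h0 h1) i
      simp only [dualGrad, Pi.add_apply, Pi.zero_apply] at h
      simp only [mulVec_sub, Pi.sub_apply, hsγ, sinhRate]
      linarith
    have hid : D γ + ∑ i, (ν γ i - νc i) * (sγ i - s i) = 0 := by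
      have h2 : ∑ i, (ν γ i - νc i) * (sγ i - s i) =
          -((ν γ - νc) ⬝ᵥ (J *ᵥ (Jᵀ *ᵥ (ν γ - νc)))) := by
        simp only [hres, dotProduct, Pi.sub_apply, mul_neg, Finset.sum_neg_distrib]
      rw [h2, Matrix.dotProduct_mulVec, ← Matrix.mulVec_transpose]
      simp [hD, dotProduct, pow_two]
    have hCS : ∀ i, |sγ i - s i| ≤ C i * √(D γ) := by
      intro i
      rw [hres, abs_neg, ← Real.sqrt_mul (Finset.sum_nonneg fun _ _ => sq_nonneg _)]
      exact Real.abs_le_sqrt (Finset.sum_mul_sq_le_sq_mul_sq Finset.univ (J i) _)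
    have h3 : -∑ i, (ν γ i - νc i) * (sγ i - s i) ≤ E γ * √(D γ) + Δ γ := by
      rw [← Finset.sum_neg_distrib, hE, hΔ]
      simp only
      rw [Finset.sum_mul, ← Finset.sum_add_distrib]
      refine Finset.sum_le_sum fun i _ => ?_
      have h4 := hbound i γ h0 h1 (ν γ i)
      have h5 := mul_le_mul_of_nonneg_left (hCS i) (hε0 i γ)
      simp only [hsγ] at h5 ⊢
      linarith
    have h6 := Real.sq_sqrt (hD0 γ)
    -- Absorption: `D ≤ E √D + Δ` and `E √D ≤ (E² + D) / 2`.
    nlinarith [sq_nonneg (E γ - √(D γ))]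
  have hDlim : Tendsto D (𝓝[>] 0) (𝓝 0) := by
    refine squeeze_zero' (Eventually.of_forall hD0)
      (eventually_mem_Ioo_zero_one.mono fun γ hγ => hmain γ hγ.1 hγ.2) ?_
    simpa using (hE0.pow 2).add (hΔ0.const_mul 2)
  rw [tendsto_pi_nhds]
  intro j
  rw [tendsto_iff_norm_sub_tendsto_zero]
  have hsq : Tendsto (fun γ => (Jᵀ *ᵥ (ν γ - νc)) j ^ 2) (𝓝[>] 0) (𝓝 0) :=
    squeeze_zero (fun _ => sq_nonneg _) (fun γ => Finset.single_le_sum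
      (f := fun j => (Jᵀ *ᵥ (ν γ - νc)) j ^ 2) (fun _ _ => sq_nonneg _) (Finset.mem_univ j)) hDlim
  have := hsq.sqrt
  simpa [Real.sqrt_sq_eq_abs, mulVec_sub] using this

/-- Two positive numbers with product `γ²` are determined by the difference of their squares. -/
theorem eq_sqrt_of_mul_eq_sq {u v γ : ℝ} (hu : 0 < u) (huv : u * v = γ ^ 2) :
    u = √(((u * u - v * v) + √((u * u - v * v) ^ 2 + 4 * γ ^ 4)) / 2) := by
  have h1 : (u * u - v * v) ^ 2 + 4 * γ ^ 4 = (u * u + v * v) ^ 2 := by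
    have : γ ^ 4 = (u * v) ^ 2 := by rw [huv]; ring
    rw [this]; ring
  rw [h1, Real.sqrt_sq (by nlinarith), show ((u * u - v * v) + (u * u + v * v)) / 2 = u ^ 2 by ring,
    Real.sqrt_sq hu.le]

/-- If `u, v > 0` have product `γ²` and `u² - v² → s`, then `u` converges as `γ → 0`. -/
theorem tendsto_of_sq_sub_sq_tendsto {u v : ℝ → ℝ} {s : ℝ}
    (hu : ∀ γ, 0 < γ → 0 < u γ) (huv : ∀ γ, 0 < γ → u γ * v γ = γ ^ 2)
    (hs : Tendsto (fun γ => u γ * u γ - v γ * v γ) (𝓝[>] 0) (𝓝 s)) :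
    Tendsto u (𝓝[>] 0) (𝓝 √((s + |s|) / 2)) := by
  have hγ : Tendsto (fun γ : ℝ => 4 * γ ^ 4) (𝓝[>] 0) (𝓝 0) := by
    have : Tendsto (fun γ : ℝ => 4 * γ ^ 4) (𝓝 0) (𝓝 (4 * 0 ^ 4)) :=
      Continuous.tendsto (by fun_prop) 0
    simp only [ne_eq, OfNat.ofNat_ne_zero, not_false_eq_true, zero_pow, mul_zero] at this
    exact this.mono_left nhdsWithin_le_nhds
  have h := ((hs.add ((hs.pow 2).add hγ).sqrt).div_const 2).sqrt
  rw [add_zero, Real.sqrt_sq_eq_abs] at h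
  refine h.congr' ?_
  filter_upwards [self_mem_nhdsWithin] with γ h0
  exact (eq_sqrt_of_mul_eq_sq (hu γ h0) (huv γ h0)).symm

end SmallInitialization

/-! ### Assembly -/

/-- In the presence of a dual certificate the limits of the gradient flow converge to the ground
truth as the initialization tends to zero. -/
theorem exists_limits_of_certificate {N p : ℕ} {J : Matrix (Fin N) (Fin p) ℝ} {lam : ℝ}
    (hlam : 0 < lam) {s νc : Fin N → ℝ} (hν : ∀ i, s i ≠ 0 → νc i = lam * Real.sign (s i))
    (hν' : ∀ i, s i = 0 → |νc i| < lam) :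
    ∃ (zlim : ℝ → Params N p) (uhat vhat : Fin N → ℝ),
      (∀ γ : ℝ, 0 < γ → γ < 1 → ∃ z : ℝ → Params N p,
        IsLimitDynamics J (J *ᵥ (Jᵀ *ᵥ νc) + s) (-Real.log γ / (2 * lam)) γ z ∧
          Tendsto z atTop (𝓝 (zlim γ))) ∧
      Tendsto zlim (𝓝[>] 0) (𝓝 (Jᵀ *ᵥ νc, uhat, vhat)) ∧
      uhat * uhat - vhat * vhat = s := by
  set y := J *ᵥ (Jᵀ *ᵥ νc) + s with hy
  have hα : ∀ γ : ℝ, 0 < γ → γ < 1 → 0 < -Real.log γ / (2 * lam) := fun γ h0 h1 => by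
    have := sinhRate_pos hlam h0 h1
    unfold sinhRate at this
    linarith
  have hex : ∀ γ : ℝ, ∃ ν : Fin N → ℝ, 0 < γ → γ < 1 →
      dualGrad J y (-Real.log γ / (2 * lam)) γ ν = 0 := fun γ => by
    by_cases h : 0 < γ ∧ γ < 1
    · obtain ⟨ν, hν⟩ := exists_dualGrad_eq_zero J y (hα γ h.1 h.2) h.1
      exact ⟨ν, fun _ _ => hν⟩
    · exact ⟨0, fun h0 h1 => absurd ⟨h0, h1⟩ h⟩
  choose ν hzero using hex
  have hθ := tendsto_transpose_mulVec_of_certificate hlam hν hν' hzero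
  set z : ℝ → Params N p := fun γ => paramsOfDual J (-Real.log γ / (2 * lam)) γ (ν γ) with hz
  have hsq : ∀ i, Tendsto (fun γ => (z γ).2.1 i * (z γ).2.1 i - (z γ).2.2 i * (z γ).2.2 i)
      (𝓝[>] 0) (𝓝 (s i)) := by
    intro i
    have h1 : Tendsto (fun γ => y i - (J *ᵥ (Jᵀ *ᵥ ν γ)) i) (𝓝[>] 0)
        (𝓝 (y i - (J *ᵥ (Jᵀ *ᵥ νc)) i)) :=
      ((((continuous_apply i).comp (contDiff_mulVec J).continuous).tendsto _).comp hθ).const_sub _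
    have h2 : y i - (J *ᵥ (Jᵀ *ᵥ νc)) i = s i := by simp [hy]
    rw [h2] at h1
    refine h1.congr' ?_
    filter_upwards [eventually_mem_Ioo_zero_one] with γ hγ
    have h3 := residual_paramsOfDual J y (-Real.log γ / (2 * lam)) γ (ν γ)
    rw [hzero γ hγ.1 hγ.2] at h3
    have h4 := congrFun h3 i
    simp only [residual, Pi.sub_apply, Pi.add_apply, Pi.mul_apply, Pi.zero_apply] at h4
    change (J *ᵥ (Jᵀ *ᵥ ν γ)) i + _ - _ - _ = _ at h4
    linarith
  have hmul : ∀ i γ, (z γ).2.1 i * (z γ).2.2 i = γ ^ 2 := fun i γ => by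
    have := Real.exp_ne_zero (2 * (-Real.log γ / (2 * lam)) * ν γ i)
    simp only [hz, paramsOfDual, Real.exp_neg]
    field_simp
  have hu0 : ∀ i γ, 0 < γ → 0 < (z γ).2.1 i := fun i γ h => mul_pos h (Real.exp_pos _)
  have hv0 : ∀ i γ, 0 < γ → 0 < (z γ).2.2 i := fun i γ h => mul_pos h (Real.exp_pos _)
  -- Square roots of the positive and the negative part of `s`.
  refine ⟨z, fun i => √((s i + |s i|) / 2), fun i => √((-s i + |-s i|) / 2), ?_, ?_, ?_⟩
  · intro γ h0 h1
    exact exists_isLimitDynamics_tendsto J y (hα γ h0 h1) h0 (hzero γ h0 h1)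
  · refine hθ.prodMk_nhds (Tendsto.prodMk_nhds ?_ ?_)
    · rw [tendsto_pi_nhds]
      exact fun i => tendsto_of_sq_sub_sq_tendsto (hu0 i) (fun γ _ => hmul i γ) (hsq i)
    · rw [tendsto_pi_nhds]
      refine fun i => tendsto_of_sq_sub_sq_tendsto (u := fun γ => (z γ).2.2 i)
        (v := fun γ => (z γ).2.1 i) (hv0 i)
        (fun γ _ => (mul_comm _ _).trans (hmul i γ)) ?_
      simpa only [neg_sub] using (hsq i).neg
  · funext i
    have h1 : 0 ≤ (s i + |s i|) / 2 := by linarith [neg_abs_le (s i)]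
    have h2 : 0 ≤ (-s i + |-s i|) / 2 := by linarith [neg_abs_le (-s i)]
    simp only [Pi.sub_apply, Pi.mul_apply, Real.mul_self_sqrt h1, Real.mul_self_sqrt h2]
    rw [abs_neg]
    ring

end SparseOverparam

theorem theorem1 {N p : ℕ} (J : Matrix (Fin N) (Fin p) ℝ) (θstar : Fin p → ℝ) (k : ℕ) :
    ∃ lam₀ : ℝ, 0 < lam₀ ∧
      ∀ (r : ℕ) (μ : ℝ) (sstar y : Fin N → ℝ) (lam : ℝ),
        J.rank = r →
        SparseOverparam.IsIncoherent J r μ →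
        (k : ℝ) ^ 2 * (r : ℝ) < (N : ℝ) / (4 * μ) →
        SparseOverparam.IsSparse k sstar →
        SparseOverparam.IsMinNormSolution J sstar y θstar →
        lam₀ < lam →
        ∃ (zlim : ℝ → SparseOverparam.Params N p) (uhat vhat : Fin N → ℝ),
          (∀ γ : ℝ, 0 < γ → γ < 1 →
            ∃ z : ℝ → SparseOverparam.Params N p,
              SparseOverparam.IsLimitDynamics J y (-Real.log γ / (2 * lam)) γ z ∧
              Tendsto z atTop (𝓝 (zlim γ))) ∧
          Tendsto zlim (𝓝[>] 0) (𝓝 (θstar, uhat, vhat)) ∧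
          uhat * uhat - vhat * vhat = sstar := by
  -- The threshold precedes `r`, `μ`, `sstar` and `y`, so `ν₀` is chosen from `J` and `θstar` alone.
  -- If no `ν₀` exists, no minimal norm solution equals `θstar` and any threshold serves.
  by_cases hθ : ∃ ν₀ : Fin N → ℝ, Jᵀ *ᵥ ν₀ = θstar
  · obtain ⟨ν₀, rfl⟩ := hθ
    refine ⟨2 * ‖ν₀‖ + 1, by positivity, ?_⟩
    intro r μ s y lam _ hinc hk hs hmin hlam
    obtain ⟨νc, hJν, hν, hν'⟩ :=
      SparseOverparam.exists_dual_certificate hinc hk hs (ν₀ := ν₀) (lam := lam) (by linarith)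
    have hlam0 : 0 < lam := lt_trans (by positivity) hlam
    rw [hmin.1, ← hJν]
    exact SparseOverparam.exists_limits_of_certificate hlam0 hν hν'
  · refine ⟨1, one_pos, fun r μ s y lam _ hinc _ _ hmin _ => absurd ?_ hθ⟩
    obtain ⟨U, σ, V, hsvd, -⟩ := hinc
    exact SparseOverparam.exists_transpose_mulVec_eq_of_isMinNormSolution hsvd hmin
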